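/- **Theorem (Pointwise asymptotic normality).** Let $T_{pre},T_{post}\in\mathbb{N}_0$ and let $(Y_1,D_1),(Y_2,D_2),\dots$ be i.i.d. copies of $(Y,D)$, where $Y=\{Y(t):t\in[-T_{pre},T_{post}]\}$ is a real-valued stochastic process and $D\in\{0,1\}$ is a treatment indicator with $0<P(D=1)<1$. Assume that the two-way fixed effects model $$Y_i(t)=\beta(t)D_i+\lambda_i+\phi(t)+\varepsilon_i(t),\qquad t\in[-T_{pre},T_{post}],$$ holds with deterministic functions $\beta,\phi$, $\beta(0)=0$, individual effects $\lambda_i$ (possibly dependent on $D_i$), and integrable errors with $\mathbb{E}[\varepsilon_i(t)\mid D_i]=0$ for all $t$. Assume $\mathbb{E}[Y(t)^4]<\infty$ for all $t\in[-T_{pre},T_{post}]$ and $\mathbb{E}[D^4]<\infty$. *Estimators.* For a sample of size $n$ put $\dot D_i=D_i-\frac1n\sum_{j=1}^nD_j$, $\dot Y_i(t)=Y_i(t)-\frac1n\sum_{j=1}^nY_j(t)$ and $$\widehat\beta_n(t)=\Big(\frac1n\sum_{i=1}^n\dot D_i^2\Big)^{-1}\Big(\frac1n\sum_{i=1}^n\dot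 D_i\big(\dot Y_i(t)-\dot Y_i(0)\big)\Big).$$ With $T=T_{pre}+T_{post}+1$, and for integers $t,s\in\{-T_{pre},\dots,T_{post}\}$, let $Y_{it}=Y_i(t)$, $D_{its}=D_i\mathbf 1_{\{t=s\}}$ and, for a panel $x_{it}$, $$\ddot x_{it}=x_{it}-\frac1T\sum_{u=-T_{pre}}^{T_{post}}x_{iu}-\frac1n\sum_{j=1}^nx_{jt}+\frac1{nT}\sum_{j=1}^n\sum_{u=-T_{pre}}^{T_{post}}x_{ju}.$$ Let $\ddot D_{it}=(\ddot D_{its})_{s\ne0}\in\mathbb{R}^{T-1}$. The panel estimator is $$(\widehat\beta^{PD}_{n,t})_{t\neq0}=\Big(\frac1{nT}\sum_{i=1}^n\sum_{t=-T_{pre}}^{T_{post}}\ddot D_{it}\ddot D_{it}^\top\Big)^{-1}\Big(\frac1{nT}\sum_{i=1}^n\sum_{t=-T_{pre}}^{T_{post}}\ddot D_{it}\ddot Y_{it}\Big),\qquad \widehat\beta^{PD}_{n,0}=0.$$ (On the event, of vanishing probability, that all $D_i$, $i\le n$, coincide, the inverses do not exist and both estimators are set to $0$.) *Conclusion.* As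 $n\to\infty$, $$\sqrt n\,\big(\widehat\beta_n(t)-\beta(t)\big)\xrightarrow{d}\mathcal N\big(0,C_\beta(t,t)\big)\quad\text{for each }t\in[-T_{pre},T_{post}],$$ $$\sqrt n\,\big(\widehat\beta^{PD}_{n,t}-\beta(t)\big)\xrightarrow{d}\mathcal N\big(0,C_\beta(t,t)\big)\quad\text{for each }t\in\{-T_{pre},\dots,T_{post}\},$$ where, writing $\varepsilon$ for the error belonging to $(Y,D)$, $\dot D=D-\mathbb{E}[D]$ and $\dot\varepsilon(t)=\varepsilon(t)-\mathbb{E}[\varepsilon(t)]$, $$C_\beta(t,t)=\mathbb{E}\big[\dot D^2(\dot\varepsilon(t)-\dot\varepsilon(0))^2\big]\,\mathbb{E}[\dot D^2]^{-2}<\infty .$$ ($\mathcal N(0,0)$ denotes the point mass at $0$.) -/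

import Mathlib

open MeasureTheory ProbabilityTheory Filter
open scoped Matrix

noncomputable section

namespace EventStudy

/-- The continuous time span `[-T_pre, T_post]`. -/
abbrev TimeSpan (Tpre Tpost : ℕ) : Type := Set.Icc (-(Tpre : ℝ)) (Tpost : ℝ)

/-- The observation times `{-T_pre, …, 0, …, T_post}`. -/
abbrev PanelTime (Tpre Tpost : ℕ) : Type := Finset.Icc (-(Tpre : ℤ)) (Tpost : ℤ)

/-- The observation times other than the reference time `0`. -/
abbrev NonRefTime (Tpre Tpost : ℕ) : Type := {s : PanelTime Tpre Tpost // (s : ℤ) ≠ 0}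

/-- The reference time `0`, as a point of `[-T_pre, T_post]`. -/
def refTime (Tpre Tpost : ℕ) : TimeSpan Tpre Tpost :=
  ⟨0, by simp⟩

/-- An observation time, as a point of `[-T_pre, T_post]`. -/
def PanelTime.toSpan {Tpre Tpost : ℕ} (t : PanelTime Tpre Tpost) : TimeSpan Tpre Tpost :=
  ⟨((t : ℤ) : ℝ), by
    have h := Finset.mem_Icc.mp t.2
    exact ⟨by exact_mod_cast h.1, by exact_mod_cast h.2⟩⟩

/-! ### Estimators, as functions of the data of the first `n` units (labelled `0, …, n - 1`) -/

/-- Cross-sectional demeaning `x_i - n⁻¹ ∑_{j<n} x_j`. -/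
def demean (n : ℕ) (x : ℕ → ℝ) (i : ℕ) : ℝ :=
  x i - (n : ℝ)⁻¹ * ∑ j ∈ Finset.range n, x j

/-- The functional oracle estimator `β̂_n(t)`, for outcome curves `y i` and treatments `d i`. -/
def betaHat {Tpre Tpost : ℕ} (n : ℕ) (y : ℕ → TimeSpan Tpre Tpost → ℝ) (d : ℕ → ℝ)
    (t : TimeSpan Tpre Tpost) : ℝ :=
  ((n : ℝ)⁻¹ * ∑ i ∈ Finset.range n, demean n d i ^ 2)⁻¹ *
    ((n : ℝ)⁻¹ * ∑ i ∈ Finset.range n, demean n d i *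
      (demean n (fun j => y j t) i - demean n (fun j => y j (refTime Tpre Tpost)) i))

/-- The two-way within transformation of a panel `x_{it}`: subtract the unit means over time and
the time means over units, add the overall mean. -/
def twoWay {Tpre Tpost : ℕ} (n : ℕ) (x : ℕ → PanelTime Tpre Tpost → ℝ)
    (i : ℕ) (t : PanelTime Tpre Tpost) : ℝ :=
  x i t - ((Tpre + Tpost + 1 : ℕ) : ℝ)⁻¹ * ∑ s, x i s
    - (n : ℝ)⁻¹ * ∑ j ∈ Finset.range n, x j t
    + ((n : ℝ) * ((Tpre + Tpost + 1 : ℕ) : ℝ))⁻¹ * ∑ j ∈ Finset.range n, ∑ s, x j s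

/-- The vector, indexed by `s ≠ 0`, of the two-way transforms of the regressors
`D_{its} = D_i 1{t = s}`. -/
def panelRegressor {Tpre Tpost : ℕ} (n : ℕ) (d : ℕ → ℝ) (i : ℕ) (t : PanelTime Tpre Tpost) :
    NonRefTime Tpre Tpost → ℝ :=
  fun s => twoWay n (fun j u => d j * (if u = s.1 then 1 else 0)) i t

/-- `(nT)⁻¹ ∑_i ∑_t D̈_{it} D̈_{it}ᵀ`. -/
def panelGram (Tpre Tpost n : ℕ) (d : ℕ → ℝ) :
    Matrix (NonRefTime Tpre Tpost) (NonRefTime Tpre Tpost) ℝ :=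
  ((n : ℝ) * ((Tpre + Tpost + 1 : ℕ) : ℝ))⁻¹ •
    ∑ i ∈ Finset.range n, ∑ t : PanelTime Tpre Tpost,
      Matrix.vecMulVec (panelRegressor n d i t) (panelRegressor n d i t)

/-- `(nT)⁻¹ ∑_i ∑_t D̈_{it} Ÿ_{it}`. -/
def panelMoment {Tpre Tpost : ℕ} (n : ℕ) (y : ℕ → PanelTime Tpre Tpost → ℝ) (d : ℕ → ℝ) :
    NonRefTime Tpre Tpost → ℝ :=
  ((n : ℝ) * ((Tpre + Tpost + 1 : ℕ) : ℝ))⁻¹ •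
    ∑ i ∈ Finset.range n, ∑ t : PanelTime Tpre Tpost, twoWay n y i t • panelRegressor n d i t

/-- The two-way fixed effects panel estimator `β̂ᴾᴰ_{n,t}`, augmented by the value `0` at the
reference time `t = 0`. -/
def betaHatPD {Tpre Tpost : ℕ} (n : ℕ) (y : ℕ → PanelTime Tpre Tpost → ℝ) (d : ℕ → ℝ)
    (t : PanelTime Tpre Tpost) : ℝ :=
  if h : (t : ℤ) ≠ 0 then ((panelGram Tpre Tpost n d)⁻¹ *ᵥ panelMoment n y d) ⟨t, h⟩ else 0

/-! ### The sampling model -/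

/-- The pairs `(Y_i, D_i)`, each a random curve on `[-T_pre, T_post]` (with the σ-algebra
generated by the point evaluations) and a random number, are i.i.d. -/
structure IsIIDSample {Ω : Type*} [MeasurableSpace Ω] {Tpre Tpost : ℕ} (μ : Measure Ω)
    (Y : ℕ → TimeSpan Tpre Tpost → Ω → ℝ) (D : ℕ → Ω → ℝ) : Prop where
  measurable_Y : ∀ i t, Measurable (Y i t)
  measurable_D : ∀ i, Measurable (D i)
  indep : iIndepFun (fun i ω => ((fun t => Y i t ω), D i ω)) μ
  identDistrib : ∀ i, IdentDistrib (fun ω => ((fun t => Y i t ω), D i ω))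
    (fun ω => ((fun t => Y 0 t ω), D 0 ω)) μ μ

/-- The two-way fixed effects function-on-scalar regression model
`Y_i(t) = β(t) D_i + λ_i + φ(t) + ε_i(t)` with a binary treatment `D_i`, `β(0) = 0` and
`E[ε_i(t) | D_i] = 0`. -/
structure IsTWFEModel {Ω : Type*} [MeasurableSpace Ω] {Tpre Tpost : ℕ} (μ : Measure Ω)
    (Y : ℕ → TimeSpan Tpre Tpost → Ω → ℝ) (D : ℕ → Ω → ℝ) (β : TimeSpan Tpre Tpost → ℝ)
    (lam : ℕ → Ω → ℝ) (φ : TimeSpan Tpre Tpost → ℝ)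
    (ε : ℕ → TimeSpan Tpre Tpost → Ω → ℝ) : Prop where
  binary : ∀ i ω, D i ω = 0 ∨ D i ω = 1
  beta_ref : β (refTime Tpre Tpost) = 0
  outcome : ∀ i t, ∀ᵐ ω ∂μ, Y i t ω = β t * D i ω + lam i ω + φ t + ε i t ω
  integrable_error : ∀ i t, Integrable (ε i t) μ
  condExp_error : ∀ i t, μ[ε i t | MeasurableSpace.comap (D i) inferInstance] =ᵐ[μ] 0

/-- Population centring `X - E[X]`. -/
def center {Ω : Type*} [MeasurableSpace Ω] (μ : Measure Ω) (X : Ω → ℝ) (ω : Ω) : ℝ :=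
  X ω - ∫ ω', X ω' ∂μ

/-- The random variable `Ḋ² (ε̇(t) - ε̇(0))²`. -/
def scoreSq {Ω : Type*} [MeasurableSpace Ω] {Tpre Tpost : ℕ} (μ : Measure Ω)
    (D : Ω → ℝ) (ε : TimeSpan Tpre Tpost → Ω → ℝ) (t : TimeSpan Tpre Tpost) (ω : Ω) : ℝ :=
  center μ D ω ^ 2 * (center μ (ε t) ω - center μ (ε (refTime Tpre Tpost)) ω) ^ 2

/-- The asymptotic variance `C_β(t,t) = E[Ḋ² (ε̇(t) - ε̇(0))²] E[Ḋ²]⁻²`. -/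
def asympVar {Ω : Type*} [MeasurableSpace Ω] {Tpre Tpost : ℕ} (μ : Measure Ω)
    (D : Ω → ℝ) (ε : TimeSpan Tpre Tpost → Ω → ℝ) (t : TimeSpan Tpre Tpost) : ℝ :=
  (∫ ω, scoreSq μ D ε t ω ∂μ) * ((∫ ω, center μ D ω ^ 2 ∂μ) ^ 2)⁻¹

end EventStudy

end

/-!
The Gram matrix of the panel regression is `T⁻¹` times the sample variance of the treatment times
the principal minor, over the times other than `0`, of the centering matrix `I - T⁻¹ 𝟏𝟏ᵀ`. This
minor is invertible and cancels against the moment vector, so for every sample the panel estimator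
at `t` is the least squares slope of `Y(t) - Y(0)` on `D`, that is, `β̂_n(t)`.

The slope of `W = b X + U` on `X` misses `b` by the sample covariance of `X` and `U` divided by the
sample variance of `X`. For uncorrelated `X` and `U` the numerator is asymptotically the sample mean
of `(X - E X) (U - E U)`, so the central limit theorem and Slutsky's lemma give the limit
`𝒩(0, Var((X - E X) (U - E U)) / Var(X)²)`, with no homoskedasticity assumption.
-/

namespace EventStudy

open scoped Topology

section Convergence

variable {ι Ω Ω' E : Type*} [MeasurableSpace Ω] [MeasurableSpace Ω'] {μ : Measure Ω}
  [IsProbabilityMeasure μ] {P : Measure Ω'} [IsProbabilityMeasure P] {l : Filter ι}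

lemma tendstoInMeasure_of_tendstoInDistribution_const [PseudoEMetricSpace E] [MeasurableSpace E]
    [BorelSpace E] {X : ι → Ω → E} {c : E}
    (h : TendstoInDistribution X l (fun _ : Ω' => c) (fun _ => μ) P) :
    TendstoInMeasure μ X l (fun _ => c) := by
  intro δ hδ
  let far : Set E := {x | δ ≤ edist x c}
  have hfar : IsClosed far := isClosed_le continuous_const (by fun_prop)
  have hnull : (P.map fun _ : Ω' => c) far = 0 := by
    simp [Measure.map_const, hfar.measurableSet, far, hδ.not_ge]
  have key := ProbabilityMeasure.tendsto_measure_of_null_frontier_of_tendsto' h.tendsto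
    (measure_mono_null hfar.frontier_subset hnull)
  simp only [ProbabilityMeasure.coe_mk, hnull] at key
  exact key.congr fun i =>
    Measure.map_apply_of_aemeasurable (h.forall_aemeasurable i) hfar.measurableSet

lemma tendstoInMeasure_mul_zero_of_tendstoInDistribution [l.IsCountablyGenerated]
    {X V : ι → Ω → ℝ} {Z : Ω' → ℝ} (hX : TendstoInDistribution X l Z (fun _ => μ) P)
    (hV : TendstoInMeasure μ V l (fun _ => 0)) (hVm : ∀ i, AEMeasurable (V i) μ) :
    TendstoInMeasure μ (fun i ω => X i ω * V i ω) l (fun _ => 0) := by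
  have h := hX.continuous_comp_prodMk_of_tendstoInMeasure_const
    (g := fun x : ℝ × ℝ => x.1 * x.2) (by fun_prop) hV hVm
  simp only [mul_zero] at h
  exact tendstoInMeasure_of_tendstoInDistribution_const h

lemma tendstoInDistribution_congr_of_ae_eventuallyEq {X Y : ℕ → Ω → ℝ} {Z : Ω' → ℝ}
    (hX : TendstoInDistribution X atTop Z (fun _ => μ) P) (hY : ∀ n, AEMeasurable (Y n) μ)
    (hXY : ∀ᵐ ω ∂μ, ∀ᶠ n in atTop, X n ω = Y n ω) :
    TendstoInDistribution Y atTop Z (fun _ => μ) P := by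
  refine tendstoInDistribution_of_tendstoInMeasure_sub Y Z hX ?_ hY
  refine tendstoInMeasure_of_tendsto_ae
    (fun n => ((hY n).sub (hX.forall_aemeasurable n)).aestronglyMeasurable) ?_
  filter_upwards [hXY] with ω hω
  refine tendsto_const_nhds.congr' ?_
  filter_upwards [hω] with n hn
  simp [hn]

end Convergence

section SampleMoments

/-- The mean of the first `n` observations; it is `0` for `n = 0`. -/
noncomputable def sampleMean (n : ℕ) (x : ℕ → ℝ) : ℝ :=
  (n : ℝ)⁻¹ * ∑ i ∈ Finset.range n, x i

/-- The covariance of the first `n` observations, with the normalisation `n⁻¹`. -/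
noncomputable def sampleCov (n : ℕ) (x y : ℕ → ℝ) : ℝ :=
  sampleMean n fun i => demean n x i * demean n y i

/-- The least squares slope in the regression of `w` on `x` and an intercept, over the first `n`
observations; it is `0` if the regressor is constant. -/
noncomputable def olsSlope (n : ℕ) (x w : ℕ → ℝ) : ℝ :=
  (sampleCov n x x)⁻¹ * sampleCov n x w

lemma demean_sub (n : ℕ) (x y : ℕ → ℝ) (i : ℕ) :
    demean n (fun j => x j - y j) i = demean n x i - demean n y i := by
  simp only [demean, Finset.sum_sub_distrib]
  ring

lemma demean_mul_const (n : ℕ) (x : ℕ → ℝ) (c : ℝ) (i : ℕ) :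
    demean n (fun j => x j * c) i = demean n x i * c := by
  simp only [demean, ← Finset.sum_mul]
  ring

lemma sampleCov_sub_right (n : ℕ) (x y z : ℕ → ℝ) :
    sampleCov n x (fun i => y i - z i) = sampleCov n x y - sampleCov n x z := by
  simp only [sampleCov, sampleMean, demean_sub, mul_sub, Finset.sum_sub_distrib]

lemma sampleCov_mul_const_right (n : ℕ) (x y : ℕ → ℝ) (c : ℝ) :
    sampleCov n x (fun i => y i * c) = sampleCov n x y * c := by
  simp only [sampleCov, sampleMean, demean_mul_const, ← mul_assoc, ← Finset.sum_mul]

lemma sampleCov_eq_sub (n : ℕ) (x y : ℕ → ℝ) :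
    sampleCov n x y = sampleMean n (fun i => x i * y i) - sampleMean n x * sampleMean n y := by
  rcases eq_or_ne n 0 with rfl | hn
  · simp [sampleCov, sampleMean]
  have hexpand : ∀ i, demean n x i * demean n y i =
      x i * y i - sampleMean n x * y i - x i * sampleMean n y + sampleMean n x * sampleMean n y :=
    fun i => by simp only [demean, sampleMean]; ring
  simp only [sampleCov, hexpand]
  simp only [sampleMean, Finset.sum_add_distrib, Finset.sum_sub_distrib, ← Finset.mul_sum,
    ← Finset.sum_mul, Finset.sum_const, Finset.card_range, nsmul_eq_mul]
  field_simp
  ring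

lemma sampleCov_sub_const (n : ℕ) (x y : ℕ → ℝ) (a b : ℝ) :
    sampleCov n (fun i => x i - a) (fun i => y i - b) = sampleCov n x y := by
  rcases eq_or_ne n 0 with rfl | hn
  · simp [sampleCov, sampleMean]
  have hconst : ∀ (z : ℕ → ℝ) (c : ℝ) (i : ℕ), demean n (fun j => z j - c) i = demean n z i := by
    intro z c i
    simp [demean, Finset.sum_sub_distrib, mul_sub, hn]
  simp only [sampleCov, hconst]

lemma olsSlope_sub_eq {n : ℕ} {x : ℕ → ℝ} (hx : sampleCov n x x ≠ 0) (w : ℕ → ℝ) (b : ℝ) :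
    olsSlope n x w - b = (sampleCov n x x)⁻¹ * sampleCov n x (fun i => w i - b * x i) := by
  simp only [olsSlope, sampleCov_sub_right, mul_comm b, sampleCov_mul_const_right]
  field_simp

end SampleMoments

section CenteringMatrix

variable {ι : Type*} [Fintype ι] [DecidableEq ι]

/-- The matrix `I - |ι|⁻¹ 𝟏𝟏ᵀ` of the orthogonal projection onto the vectors of mean zero. -/
noncomputable def centeringMatrix (ι : Type*) [Fintype ι] [DecidableEq ι] : Matrix ι ι ℝ :=
  1 - (Fintype.card ι : ℝ)⁻¹ • Matrix.of fun _ _ => 1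

lemma centeringMatrix_apply (i j : ι) :
    centeringMatrix ι i j = (if i = j then 1 else 0) - (Fintype.card ι : ℝ)⁻¹ := by
  simp [centeringMatrix, Matrix.one_apply]

lemma centeringMatrix_mulVec_apply (v : ι → ℝ) (i : ι) :
    (centeringMatrix ι *ᵥ v) i = v i - (Fintype.card ι : ℝ)⁻¹ * ∑ j, v j := by
  simp [Matrix.mulVec, dotProduct, centeringMatrix_apply, sub_mul, Finset.sum_sub_distrib,
    Finset.mul_sum]

lemma centeringMatrix_isSymm : (centeringMatrix ι).IsSymm :=
  Matrix.IsSymm.ext fun i j => by simp only [centeringMatrix_apply, eq_comm]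

lemma centeringMatrix_mulVec_const (c : ℝ) : centeringMatrix ι *ᵥ (fun _ => c) = 0 := by
  ext i
  have : Nonempty ι := ⟨i⟩
  simp [centeringMatrix_mulVec_apply]

lemma centeringMatrix_mulVec_centeringMatrix_mulVec (v : ι → ℝ) :
    centeringMatrix ι *ᵥ (centeringMatrix ι *ᵥ v) = centeringMatrix ι *ᵥ v := by
  have hv : centeringMatrix ι *ᵥ v = v - fun _ => (Fintype.card ι : ℝ)⁻¹ * ∑ j, v j :=
    funext (centeringMatrix_mulVec_apply v)
  conv_lhs => rw [hv, Matrix.mulVec_sub, centeringMatrix_mulVec_const, sub_zero]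

lemma centeringMatrix_mul_self : centeringMatrix ι * centeringMatrix ι = centeringMatrix ι :=
  Matrix.ext_of_mulVec_single fun i => by
    rw [← Matrix.mulVec_mulVec, centeringMatrix_mulVec_centeringMatrix_mulVec]

end CenteringMatrix

section CenteringMinor

variable {ι : Type*} [Fintype ι] {p : ι → Prop} [Fintype (Subtype p)] {r : ι}

lemma sum_subtype_eq_sub (hp : ∀ i, p i ↔ i ≠ r) (f : ι → ℝ) :
    ∑ i : Subtype p, f i = ∑ i, f i - f r := by
  classical
  rw [← Finset.sum_erase_eq_sub (Finset.mem_univ r)]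
  exact (Finset.sum_subtype _ (by simp [hp]) f).symm

variable [DecidableEq ι]

lemma isUnit_det_centeringMatrix_submatrix [DecidableEq (Subtype p)] (hp : ∀ i, p i ↔ i ≠ r) :
    IsUnit ((centeringMatrix ι).submatrix (Subtype.val : Subtype p → ι) Subtype.val).det := by
  refine Matrix.isUnit_det_of_right_inverse (B := 1 + Matrix.of fun _ _ => 1) ?_
  ext s s'
  have hrow : ∑ u, centeringMatrix ι s u = 0 := by
    simpa [Matrix.mulVec, dotProduct] using congrFun (centeringMatrix_mulVec_const (ι := ι) 1) s
  have hsum : ∑ u : Subtype p, centeringMatrix ι s u = (Fintype.card ι : ℝ)⁻¹ := by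
    rw [sum_subtype_eq_sub hp, hrow, centeringMatrix_apply, if_neg ((hp s).mp s.2)]
    ring
  rw [mul_add, mul_one, Matrix.add_apply, Matrix.mul_apply]
  simp only [Matrix.submatrix_apply, Matrix.of_apply, mul_one, hsum]
  rw [centeringMatrix_apply, sub_add_cancel, Matrix.one_apply]
  simp only [Subtype.ext_iff]

-- Subtracting the constant `v r` does not change the centred vector and kills the coordinate `r`.
lemma centeringMatrix_mulVec_eq_submatrix_mulVec (hp : ∀ i, p i ↔ i ≠ r) (v : ι → ℝ)
    (s : Subtype p) :
    (centeringMatrix ι *ᵥ v) s =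
      ((centeringMatrix ι).submatrix Subtype.val Subtype.val *ᵥ
        fun u : Subtype p => v u - v r) s := by
  calc (centeringMatrix ι *ᵥ v) s = (centeringMatrix ι *ᵥ (v - fun _ => v r)) s := by
        rw [Matrix.mulVec_sub, centeringMatrix_mulVec_const, sub_zero]
    _ = ∑ u : Subtype p, centeringMatrix ι s u * (v u - v r) := by
        rw [sum_subtype_eq_sub hp fun u => centeringMatrix ι s u * (v u - v r)]
        simp [Matrix.mulVec, dotProduct]

end CenteringMinor

lemma inv_smul_mulVec_mulVec {ι K : Type*} [Fintype ι] [DecidableEq ι] [Field K]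
    {A : Matrix ι ι K} (hA : IsUnit A.det) (k : K) (w : ι → K) :
    (k • A)⁻¹ *ᵥ (A *ᵥ w) = k⁻¹ • w := by
  rcases eq_or_ne k 0 with rfl | hk
  · simp
  have := invertibleOfNonzero hk
  rw [A.inv_smul k hA, invOf_eq_inv, Matrix.smul_mulVec, Matrix.mulVec_mulVec,
    Matrix.nonsing_inv_mul A hA, Matrix.one_mulVec]

section Panel

variable {Tpre Tpost : ℕ}

/-- The reference time `0`, as an observation time. -/
def panelRef (Tpre Tpost : ℕ) : PanelTime Tpre Tpost := ⟨0, by simp⟩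

lemma toSpan_panelRef : (panelRef Tpre Tpost).toSpan = refTime Tpre Tpost := by
  simp [PanelTime.toSpan, panelRef, refTime]

lemma ne_zero_iff_ne_panelRef (t : PanelTime Tpre Tpost) :
    (t : ℤ) ≠ 0 ↔ t ≠ panelRef Tpre Tpost := by
  simp [panelRef, Subtype.ext_iff]

lemma card_panelTime : Fintype.card (PanelTime Tpre Tpost) = Tpre + Tpost + 1 := by
  simp only [Fintype.card_coe, Int.card_Icc]
  omega

lemma twoWay_eq_centeringMatrix_mulVec (n : ℕ) (x : ℕ → PanelTime Tpre Tpost → ℝ) (i : ℕ) :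
    twoWay n x i = centeringMatrix _ *ᵥ fun t => demean n (fun j => x j t) i := by
  ext t
  simp only [centeringMatrix_mulVec_apply, card_panelTime, twoWay, demean, Finset.sum_sub_distrib,
    ← Finset.mul_sum]
  rw [Finset.sum_comm (s := Finset.univ), mul_inv]
  ring

lemma panelRegressor_eq_demean_mul (n : ℕ) (d : ℕ → ℝ) (i : ℕ) (t : PanelTime Tpre Tpost)
    (s : NonRefTime Tpre Tpost) :
    panelRegressor n d i t s = demean n d i * centeringMatrix _ t s.1 := by
  simp only [panelRegressor, twoWay_eq_centeringMatrix_mulVec, demean_mul_const,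
    Matrix.mulVec, dotProduct]
  simp [mul_comm]

lemma panelGram_eq_smul_submatrix (n : ℕ) (d : ℕ → ℝ) :
    panelGram Tpre Tpost n d = (((Tpre + Tpost + 1 : ℕ) : ℝ)⁻¹ * sampleCov n d d) •
      (centeringMatrix (PanelTime Tpre Tpost)).submatrix Subtype.val Subtype.val := by
  ext s s'
  have hidem : ∑ t, centeringMatrix (PanelTime Tpre Tpost) t s.1 * centeringMatrix _ t s'.1 =
      centeringMatrix _ s.1 s'.1 := by
    simp only [fun t => centeringMatrix_isSymm.apply (s : PanelTime Tpre Tpost) t]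
    rw [← Matrix.mul_apply, centeringMatrix_mul_self]
  simp only [panelGram, Matrix.smul_apply, Matrix.sum_apply, Matrix.vecMulVec_apply,
    panelRegressor_eq_demean_mul, mul_mul_mul_comm (demean n d _), ← Finset.mul_sum, hidem,
    ← Finset.sum_mul, sampleCov, sampleMean, Matrix.submatrix_apply, smul_eq_mul, mul_inv]
  ring

lemma panelMoment_apply (n : ℕ) (y : ℕ → PanelTime Tpre Tpost → ℝ) (d : ℕ → ℝ)
    (s : NonRefTime Tpre Tpost) :
    panelMoment n y d s = ((Tpre + Tpost + 1 : ℕ) : ℝ)⁻¹ *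
      (centeringMatrix _ *ᵥ fun u => sampleCov n d fun j => y j u) s.1 := by
  have hidem : ∀ i, ∑ t, twoWay n y i t * centeringMatrix _ t s.1 = twoWay n y i s.1 := by
    intro i
    simp only [fun t => centeringMatrix_isSymm.apply (s : PanelTime Tpre Tpost) t, mul_comm,
      twoWay_eq_centeringMatrix_mulVec]
    exact congrFun (centeringMatrix_mulVec_centeringMatrix_mulVec _) s.1
  simp only [panelMoment, Pi.smul_apply, Finset.sum_apply, smul_eq_mul,
    panelRegressor_eq_demean_mul, mul_left_comm _ (demean n d _), ← Finset.mul_sum, hidem]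
  simp only [twoWay_eq_centeringMatrix_mulVec, Matrix.mulVec, dotProduct, sampleCov, sampleMean,
    Finset.mul_sum]
  rw [Finset.sum_comm]
  refine Finset.sum_congr rfl fun u _ => Finset.sum_congr rfl fun i _ => ?_
  rw [mul_inv]
  ring

lemma inv_panelGram_mulVec_panelMoment (n : ℕ) (y : ℕ → PanelTime Tpre Tpost → ℝ) (d : ℕ → ℝ) :
    (panelGram Tpre Tpost n d)⁻¹ *ᵥ panelMoment n y d =
      fun s => olsSlope n d fun j => y j s.1 - y j (panelRef Tpre Tpost) := by
  have hT : ((Tpre + Tpost + 1 : ℕ) : ℝ) ≠ 0 := by positivity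
  let C : Matrix (NonRefTime Tpre Tpost) (NonRefTime Tpre Tpost) ℝ :=
    (centeringMatrix (PanelTime Tpre Tpost)).submatrix Subtype.val Subtype.val
  let w : NonRefTime Tpre Tpost → ℝ :=
    fun s => sampleCov n d fun j => y j s.1 - y j (panelRef Tpre Tpost)
  have hC : IsUnit C.det := isUnit_det_centeringMatrix_submatrix ne_zero_iff_ne_panelRef
  have hgram : panelGram Tpre Tpost n d =
      (((Tpre + Tpost + 1 : ℕ) : ℝ)⁻¹ * sampleCov n d d) • C := panelGram_eq_smul_submatrix n d
  have hmoment : panelMoment n y d = ((Tpre + Tpost + 1 : ℕ) : ℝ)⁻¹ • (C *ᵥ w) := by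
    ext s
    simp only [panelMoment_apply, w, sampleCov_sub_right, Pi.smul_apply, smul_eq_mul]
    rw [centeringMatrix_mulVec_eq_submatrix_mulVec ne_zero_iff_ne_panelRef _ s]
  rw [hgram, hmoment, Matrix.mulVec_smul, inv_smul_mulVec_mulVec hC, smul_smul, mul_inv, inv_inv,
    inv_mul_cancel_left₀ hT]
  rfl

lemma betaHat_eq_olsSlope (n : ℕ) (y : ℕ → TimeSpan Tpre Tpost → ℝ) (d : ℕ → ℝ)
    (t : TimeSpan Tpre Tpost) :
    betaHat n y d t = olsSlope n d fun j => y j t - y j (refTime Tpre Tpost) := by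
  simp only [betaHat, olsSlope, sampleCov, sampleMean, demean_sub, pow_two]

theorem betaHatPD_eq_betaHat (n : ℕ) (y : ℕ → TimeSpan Tpre Tpost → ℝ) (d : ℕ → ℝ)
    (t : PanelTime Tpre Tpost) :
    betaHatPD n (fun i s => y i s.toSpan) d t = betaHat n y d t.toSpan := by
  rw [betaHatPD]
  split_ifs with ht
  · rw [inv_panelGram_mulVec_panelMoment, betaHat_eq_olsSlope, toSpan_panelRef]
  · have href : t = panelRef Tpre Tpost := Subtype.ext (not_not.mp ht)
    simp [href, toSpan_panelRef, betaHat]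

end Panel

section IID

variable {Ω E F : Type*} [MeasurableSpace Ω] [MeasurableSpace E] [MeasurableSpace F]
  {μ : Measure Ω} {Z : ℕ → Ω → E}

/-- The random elements `Z 0, Z 1, …` are independent and identically distributed. -/
structure IsIID (Z : ℕ → Ω → E) (μ : Measure Ω) : Prop where
  indep : iIndepFun Z μ
  identDistrib : ∀ i, IdentDistrib (Z i) (Z 0) μ μ

lemma IsIID.comp (h : IsIID Z μ) {g : E → F} (hg : Measurable g) :
    IsIID (fun i ω => g (Z i ω)) μ :=
  ⟨h.indep.comp (fun _ => g) fun _ => hg, fun i => (h.identDistrib i).comp hg⟩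

lemma IsIID.aemeasurable (h : IsIID Z μ) (i : ℕ) : AEMeasurable (Z i) μ :=
  (h.identDistrib i).aemeasurable_fst

end IID

section Asymptotics

variable {Ω Ω' : Type*} [MeasurableSpace Ω] [MeasurableSpace Ω'] {μ : Measure Ω}
  {P : Measure Ω'} {G : Ω' → ℝ} {X U W Z : ℕ → Ω → ℝ}

lemma aemeasurable_sampleMean (hZ : ∀ i, AEMeasurable (Z i) μ) (n : ℕ) :
    AEMeasurable (fun ω => sampleMean n fun i => Z i ω) μ := by
  unfold sampleMean
  fun_prop

lemma aemeasurable_sampleCov (hX : ∀ i, AEMeasurable (X i) μ) (hU : ∀ i, AEMeasurable (U i) μ)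
    (n : ℕ) : AEMeasurable (fun ω => sampleCov n (fun i => X i ω) (fun i => U i ω)) μ := by
  unfold sampleCov sampleMean demean
  fun_prop

lemma IsIID.ae_tendsto_sampleMean (h : IsIID Z μ) (hZ : Integrable (Z 0) μ) :
    ∀ᵐ ω ∂μ, Tendsto (fun n => sampleMean n fun i => Z i ω) atTop (𝓝 μ[Z 0]) :=
  strong_law_ae Z hZ (fun _ _ hij => h.indep.indepFun hij) h.identDistrib

lemma sqrt_mul_sampleMean_sub (n : ℕ) (x : ℕ → ℝ) (m : ℝ) :
    √n * (sampleMean n x - m) = (√n)⁻¹ * (∑ i ∈ Finset.range n, x i - n * m) := by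
  rcases n.eq_zero_or_pos with rfl | hn
  · simp
  have hn' : (0 : ℝ) < n := Nat.cast_pos.mpr hn
  rw [sampleMean]
  field_simp
  rw [Real.sq_sqrt hn'.le]

variable [IsProbabilityMeasure μ]

lemma IsIID.tendstoInDistribution_sqrt_mul_sampleMean_sub [IsProbabilityMeasure P]
    (h : IsIID Z μ) (hZ : MemLp (Z 0) 2 μ)
    (hG : HasLaw G (gaussianReal 0 Var[Z 0; μ].toNNReal) P) :
    TendstoInDistribution (fun (n : ℕ) ω => √n * (sampleMean n (fun i => Z i ω) - μ[Z 0]))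
      atTop G (fun _ => μ) P := by
  simp only [sqrt_mul_sampleMean_sub]
  exact tendstoInDistribution_inv_sqrt_mul_sum_sub hG hZ h.indep h.identDistrib

lemma IsIID.ae_tendsto_sampleCov (h : IsIID (fun i ω => (X i ω, U i ω)) μ)
    (hX : MemLp (X 0) 2 μ) (hU : MemLp (U 0) 2 μ) :
    ∀ᵐ ω ∂μ, Tendsto (fun n => sampleCov n (fun i => X i ω) (fun i => U i ω)) atTop
      (𝓝 cov[X 0, U 0; μ]) := by
  simp only [sampleCov_eq_sub, covariance_eq_sub hX hU]
  filter_upwards [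
    (h.comp (g := fun p : ℝ × ℝ => p.1 * p.2) (by fun_prop)).ae_tendsto_sampleMean
      (hX.integrable_mul hU),
    (h.comp measurable_fst).ae_tendsto_sampleMean (hX.integrable one_le_two),
    (h.comp measurable_snd).ae_tendsto_sampleMean (hU.integrable one_le_two)]
    with ω hXU hX' hU'
  exact hXU.sub (hX'.mul hU')

-- The product of the sample means is an `O(n^(-1/2))` times an `o(1)` term, so only the sample
-- mean of the products `X i * U i` contributes to the limit.
lemma IsIID.tendstoInDistribution_sqrt_mul_sampleCov_sub_of_integral_eq_zero
    [IsProbabilityMeasure P] (h : IsIID (fun i ω => (X i ω, U i ω)) μ)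
    (hX : MemLp (X 0) 2 μ) (hU : Integrable (U 0) μ)
    (hXU : MemLp (fun ω => X 0 ω * U 0 ω) 2 μ) (hX0 : μ[X 0] = 0) (hU0 : μ[U 0] = 0)
    (hG : HasLaw G (gaussianReal 0 Var[fun ω => X 0 ω * U 0 ω; μ].toNNReal) P) :
    TendstoInDistribution
      (fun (n : ℕ) ω =>
        √n * (sampleCov n (fun i => X i ω) (fun i => U i ω) - ∫ ω', X 0 ω' * U 0 ω' ∂μ))
      atTop G (fun _ => μ) P := by
  have hXiid : IsIID X μ := h.comp measurable_fst
  have hUiid : IsIID U μ := h.comp measurable_snd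
  have hmeanU := aemeasurable_sampleMean hUiid.aemeasurable
  have hprod := (h.comp (g := fun p : ℝ × ℝ => p.1 * p.2) (by fun_prop)
    ).tendstoInDistribution_sqrt_mul_sampleMean_sub hXU hG
  have hcltX := hXiid.tendstoInDistribution_sqrt_mul_sampleMean_sub hX HasLaw.id
  have hllnU : TendstoInMeasure μ (fun n ω => sampleMean n fun i => U i ω) atTop fun _ => 0 :=
    tendstoInMeasure_of_tendsto_ae (fun n => (hmeanU n).aestronglyMeasurable)
      (by simpa only [hU0] using hUiid.ae_tendsto_sampleMean hU)
  have hrest := tendstoInMeasure_mul_zero_of_tendstoInDistribution hcltX hllnU hmeanU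
  have hdiff := hprod.continuous_comp_prodMk_of_tendstoInMeasure_const
    (g := fun p : ℝ × ℝ => p.1 - p.2) (by fun_prop) hrest
    fun n => (hcltX.forall_aemeasurable n).mul (hmeanU n)
  simp only [sub_zero, hX0] at hdiff
  refine hdiff.congr (fun n => ae_of_all _ fun ω => ?_) (ae_of_all _ fun _ => rfl)
  simp only [sampleCov_eq_sub]
  ring

lemma integral_center {Z : Ω → ℝ} (hZ : Integrable Z μ) : ∫ ω, center μ Z ω ∂μ = 0 := by
  simp [center, integral_sub hZ (integrable_const _)]

lemma IsIID.tendstoInDistribution_sqrt_mul_sampleCov_sub [IsProbabilityMeasure P]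
    (h : IsIID (fun i ω => (X i ω, U i ω)) μ) (hX : MemLp (X 0) 2 μ) (hU : Integrable (U 0) μ)
    (hXU : MemLp (fun ω => center μ (X 0) ω * center μ (U 0) ω) 2 μ)
    (hG : HasLaw G (gaussianReal 0
      Var[fun ω => center μ (X 0) ω * center μ (U 0) ω; μ].toNNReal) P) :
    TendstoInDistribution
      (fun (n : ℕ) ω =>
        √n * (sampleCov n (fun i => X i ω) (fun i => U i ω) - cov[X 0, U 0; μ]))
      atTop G (fun _ => μ) P := by
  have hcentered := h.comp (g := fun p : ℝ × ℝ => (p.1 - μ[X 0], p.2 - μ[U 0])) (by fun_prop)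
  have key := hcentered.tendstoInDistribution_sqrt_mul_sampleCov_sub_of_integral_eq_zero
    (hX.sub (memLp_const _)) (hU.sub (integrable_const _)) hXU
    (integral_center (hX.integrable one_le_two)) (integral_center hU) hG
  simp only [sampleCov_sub_const] at key
  exact key

lemma hasLaw_const_mul_gaussianReal {v c : ℝ} (hv : 0 ≤ v) (hc : c ≠ 0) :
    HasLaw (fun x => c * x) (gaussianReal 0 v.toNNReal) (gaussianReal 0 (v / c ^ 2).toNNReal) := by
  have h := gaussianReal_const_mul (P := gaussianReal 0 (v / c ^ 2).toNNReal) HasLaw.id c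
  convert! h using 2
  · simp
  · ext
    simp only [NNReal.coe_mul, NNReal.coe_mk]
    rw [Real.coe_toNNReal _ hv, Real.coe_toNNReal _ (by positivity)]
    field_simp

theorem IsIID.tendstoInDistribution_olsSlope (h : IsIID (fun i ω => (X i ω, W i ω)) μ)
    (hX : MemLp (X 0) 2 μ) (hvar : Var[X 0; μ] ≠ 0) (hW : Integrable (W 0) μ) {b : ℝ}
    (hcov : cov[X 0, fun ω => W 0 ω - b * X 0 ω; μ] = 0)
    (hscore : MemLp
      (fun ω => center μ (X 0) ω * center μ (fun ω' => W 0 ω' - b * X 0 ω') ω) 2 μ) :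
    TendstoInDistribution
      (fun (n : ℕ) ω => √n * (olsSlope n (fun i => X i ω) (fun i => W i ω) - b))
      atTop id (fun _ => μ)
      (gaussianReal 0
        (Var[fun ω => center μ (X 0) ω * center μ (fun ω' => W 0 ω' - b * X 0 ω') ω; μ] /
          Var[X 0; μ] ^ 2).toNNReal) := by
  have hXm : ∀ i, AEMeasurable (X i) μ := (h.comp measurable_fst).aemeasurable
  have hWm : ∀ i, AEMeasurable (W i) μ := (h.comp measurable_snd).aemeasurable
  have hSm := aemeasurable_sampleCov hXm hXm
  have hS := (h.comp (g := fun p : ℝ × ℝ => (p.1, p.1)) (by fun_prop)).ae_tendsto_sampleCov hX hX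
  rw [covariance_self hX.aemeasurable] at hS
  have hnum := (h.comp (g := fun p : ℝ × ℝ => (p.1, p.2 - b * p.1)) (by fun_prop)
    ).tendstoInDistribution_sqrt_mul_sampleCov_sub hX
      (hW.sub ((hX.integrable one_le_two).const_mul b)) hscore
      (hasLaw_const_mul_gaussianReal (variance_nonneg _ _) hvar)
  have hSinv : TendstoInMeasure μ
      (fun n ω => (sampleCov n (fun i => X i ω) (fun i => X i ω))⁻¹) atTop
      (fun _ => Var[X 0; μ]⁻¹) := by
    refine tendstoInMeasure_of_tendsto_ae (fun n => (hSm n).inv.aestronglyMeasurable) ?_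
    filter_upwards [hS] with ω hω using hω.inv₀ hvar
  have hratio := hnum.continuous_comp_prodMk_of_tendstoInMeasure_const
    (g := fun p : ℝ × ℝ => p.2 * p.1) (by fun_prop) hSinv fun n => (hSm n).inv
  simp only [hcov, sub_zero, inv_mul_cancel_left₀ hvar] at hratio
  refine tendstoInDistribution_congr_of_ae_eventuallyEq hratio (fun n => ?_) ?_
  · exact (((hSm n).inv.mul (aemeasurable_sampleCov hXm hWm n)).sub_const b).const_mul _
  · filter_upwards [hS] with ω hω
    filter_upwards [hω.eventually_ne hvar] with n hn
    rw [olsSlope_sub_eq hn]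
    ring

end Asymptotics

section Moments

variable {Ω : Type*} {mΩ : MeasurableSpace Ω} {μ : Measure Ω} {X Z : Ω → ℝ}

lemma center_ae_congr (h : X =ᵐ[μ] Z) : center μ X =ᵐ[μ] center μ Z := by
  filter_upwards [h] with ω hω
  simp only [center, hω, integral_congr_ae h]

lemma center_const_add [IsProbabilityMeasure μ] (hZ : Integrable Z μ) (c : ℝ) :
    center μ (fun ω => c + Z ω) = center μ Z := by
  ext ω
  simp [center, integral_add (integrable_const c) hZ]

lemma aemeasurable_center_mul_center (hX : AEMeasurable X μ) (hZ : AEMeasurable Z μ) :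
    AEMeasurable (fun ω => center μ X ω * center μ Z ω) μ :=
  (hX.sub_const _).mul (hZ.sub_const _)

lemma memLp_of_integrable_pow {p : ℕ} (hp : p ≠ 0) (hX : AEStronglyMeasurable X μ)
    (h : Integrable (fun ω => X ω ^ p) μ) : MemLp X p μ := by
  rw [← integrable_norm_rpow_iff hX (by exact_mod_cast hp) (by simp)]
  simpa using h.norm

lemma variance_ne_zero_of_measure_eq [IsProbabilityMeasure μ] (hX : MemLp X 2 μ) {a : ℝ}
    (hpos : 0 < μ {ω | X ω = a}) (hlt : μ {ω | X ω = a} < 1) : Var[X; μ] ≠ 0 := by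
  intro h
  have hconst := ae_eq_integral_of_variance_eq_zero hX h
  rcases eq_or_ne μ[X] a with ha | ha
  · refine hlt.ne ((prob_compl_eq_zero_iff₀ ?_).mp ?_)
    · exact hX.1.nullMeasurableSet_eq_fun aestronglyMeasurable_const
    · simpa only [ha] using mem_ae_iff.mp hconst
  · refine hpos.ne' (measure_eq_zero_iff_ae_notMem.mpr ?_)
    filter_upwards [hconst] with ω hω hωa
    exact ha (hω.symm.trans hωa)

lemma covariance_eq_zero_of_condExp_eq_zero [IsProbabilityMeasure μ] (hXm : Measurable X)
    (hX : MemLp X 2 μ) (hZ : MemLp Z 2 μ)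
    (hcond : μ[Z | MeasurableSpace.comap X inferInstance] =ᵐ[μ] 0) : cov[X, Z; μ] = 0 := by
  have hmean : μ[Z] = 0 := by
    rw [← integral_condExp hXm.comap_le, integral_congr_ae hcond]
    simp
  have hpull : μ[X * Z | MeasurableSpace.comap X inferInstance] =ᵐ[μ] 0 := by
    refine (condExp_mul_of_aestronglyMeasurable_left
      (comap_measurable X).stronglyMeasurable.aestronglyMeasurable
      (hX.integrable_mul hZ) (hZ.integrable one_le_two)).trans ?_
    filter_upwards [hcond] with ω hω
    simp [hω]
  rw [covariance_eq_sub hX hZ, hmean, mul_zero, sub_zero,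
    ← integral_condExp hXm.comap_le, integral_congr_ae hpull]
  simp

end Moments

section Model

variable {Ω : Type*} [MeasurableSpace Ω] {μ : Measure Ω} {Tpre Tpost : ℕ}

/-- The increment `x(t) - x(0)` of a random curve from the reference time. -/
def increment (x : TimeSpan Tpre Tpost → Ω → ℝ) (t : TimeSpan Tpre Tpost) (ω : Ω) : ℝ :=
  x t ω - x (refTime Tpre Tpost) ω

variable {ε : TimeSpan Tpre Tpost → Ω → ℝ} {d : Ω → ℝ} {t : TimeSpan Tpre Tpost}

lemma integrable_increment (hε : ∀ s, Integrable (ε s) μ) : Integrable (increment ε t) μ :=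
  (hε t).sub (hε _)

lemma scoreSq_eq_sq (hε : ∀ s, Integrable (ε s) μ) :
    scoreSq μ d ε t = fun ω => (center μ d ω * center μ (increment ε t) ω) ^ 2 := by
  ext ω
  simp only [scoreSq, center, increment, integral_sub (hε _) (hε _)]
  ring

lemma asympVar_eq_variance_div [IsProbabilityMeasure μ] (hε : ∀ s, Integrable (ε s) μ)
    (hd : AEMeasurable d μ) (hcov : cov[d, increment ε t; μ] = 0) :
    asympVar μ d ε t =
      Var[fun ω => center μ d ω * center μ (increment ε t) ω; μ] / Var[d; μ] ^ 2 := by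
  have hmeas := aemeasurable_center_mul_center hd (integrable_increment (t := t) hε).aemeasurable
  rw [asympVar, scoreSq_eq_sq hε, variance_of_integral_eq_zero hmeas hcov,
    variance_eq_integral hd, div_eq_mul_inv]
  rfl

lemma memLp_two_center_mul_center_increment (hε : ∀ s, Integrable (ε s) μ)
    (hd : AEMeasurable d μ) (hscore : Integrable (scoreSq μ d ε t) μ) :
    MemLp (fun ω => center μ d ω * center μ (increment ε t) ω) 2 μ := by
  have hmeas := aemeasurable_center_mul_center hd (integrable_increment (t := t) hε).aemeasurable
  rw [memLp_two_iff_integrable_sq hmeas.aestronglyMeasurable]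
  rwa [scoreSq_eq_sq hε] at hscore

variable {Y : ℕ → TimeSpan Tpre Tpost → Ω → ℝ} {D : ℕ → Ω → ℝ} {β φ : TimeSpan Tpre Tpost → ℝ}

lemma IsIIDSample.isIID_increment (h : IsIIDSample μ Y D) (t : TimeSpan Tpre Tpost) :
    IsIID (fun i ω => (D i ω, increment (Y i) t ω)) μ :=
  (IsIID.mk h.indep h.identDistrib).comp (g := fun p : (TimeSpan Tpre Tpost → ℝ) × ℝ =>
    (p.2, p.1 t - p.1 (refTime Tpre Tpost))) (by fun_prop)

lemma increment_sub_ae_eq {y : TimeSpan Tpre Tpost → Ω → ℝ} {lam : Ω → ℝ}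
    (href : β (refTime Tpre Tpost) = 0)
    (hy : ∀ s, ∀ᵐ ω ∂μ, y s ω = β s * d ω + lam ω + φ s + ε s ω) (t : TimeSpan Tpre Tpost) :
    (fun ω => increment y t ω - β t * d ω) =ᵐ[μ]
      fun ω => (φ t - φ (refTime Tpre Tpost)) + increment ε t ω := by
  filter_upwards [hy t, hy (refTime Tpre Tpost)] with ω ht h0
  simp only [increment, ht, h0, href]
  ring

theorem tendstoInDistribution_betaHat [IsProbabilityMeasure μ] {lam : Ω → ℝ}
    (hiid : IsIIDSample μ Y D) (href : β (refTime Tpre Tpost) = 0)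
    (houtcome : ∀ s, ∀ᵐ ω ∂μ, Y 0 s ω = β s * D 0 ω + lam ω + φ s + ε s ω)
    (hε : ∀ s, Integrable (ε s) μ) (hD : MemLp (D 0) 2 μ) (hvar : Var[D 0; μ] ≠ 0)
    (hcov : cov[D 0, increment ε t; μ] = 0) (hscore : Integrable (scoreSq μ (D 0) ε t) μ) :
    TendstoInDistribution
      (fun (n : ℕ) ω => √n * (betaHat n (fun i s => Y i s ω) (fun i => D i ω) t - β t))
      atTop id (fun _ => μ) (gaussianReal 0 (asympVar μ (D 0) ε t).toNNReal) := by
  have hres := increment_sub_ae_eq href houtcome t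
  have hΔε : Integrable (increment ε t) μ := integrable_increment hε
  have hY : Integrable (increment (Y 0) t) μ := by
    refine (((integrable_const (φ t - φ (refTime Tpre Tpost))).add hΔε).add
      ((hD.integrable one_le_two).const_mul (β t))).congr ?_
    filter_upwards [hres] with ω hω
    exact (eq_add_of_sub_eq hω).symm
  have hcenter : center μ (fun ω => increment (Y 0) t ω - β t * D 0 ω) =ᵐ[μ]
      center μ (increment ε t) := by
    rw [← center_const_add hΔε (φ t - φ (refTime Tpre Tpost))]
    exact center_ae_congr hres
  have hprod : (fun ω => center μ (D 0) ω *
        center μ (fun ω' => increment (Y 0) t ω' - β t * D 0 ω') ω) =ᵐ[μ]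
      fun ω => center μ (D 0) ω * center μ (increment ε t) ω := by
    filter_upwards [hcenter] with ω hω
    rw [hω]
  have h := (hiid.isIID_increment t).tendstoInDistribution_olsSlope hD hvar hY (b := β t)
    ((integral_congr_ae hprod).trans hcov)
    ((memLp_congr_ae hprod).mpr
      (memLp_two_center_mul_center_increment hε hD.aemeasurable hscore))
  rw [variance_congr hprod, ← asympVar_eq_variance_div hε hD.aemeasurable hcov] at h
  simp only [betaHat_eq_olsSlope]
  exact h

namespace IsTWFEModel

variable [IsProbabilityMeasure μ] {lam : ℕ → Ω → ℝ} {ε : ℕ → TimeSpan Tpre Tpost → Ω → ℝ}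

lemma memLp_four_increment (hmodel : IsTWFEModel μ Y D β lam φ ε) (hiid : IsIIDSample μ Y D)
    (hY : ∀ s, Integrable (fun ω => Y 0 s ω ^ 4) μ) (hD : MemLp (D 0) 4 μ)
    (t : TimeSpan Tpre Tpost) : MemLp (increment (ε 0) t) 4 μ := by
  have hY4 (s) : MemLp (Y 0 s) 4 μ := memLp_of_integrable_pow four_ne_zero
    (hiid.measurable_Y 0 s).aestronglyMeasurable (hY s)
  refine (memLp_congr_ae ?_).mpr ((((hY4 t).sub (hY4 (refTime Tpre Tpost))).sub
    (hD.const_mul (β t))).sub (memLp_const (φ t - φ (refTime Tpre Tpost))))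
  filter_upwards [increment_sub_ae_eq hmodel.beta_ref (hmodel.outcome 0) t] with ω hω
  exact (sub_eq_of_eq_add' hω).symm

lemma integrable_scoreSq (hmodel : IsTWFEModel μ Y D β lam φ ε)
    (hΔε : MemLp (increment (ε 0) t) 4 μ) (hD : MemLp (D 0) 4 μ) :
    Integrable (scoreSq μ (D 0) (ε 0) t) μ := by
  have : ENNReal.HolderTriple 4 4 2 := .of_toReal (by constructor <;> norm_num)
  have hprod : MemLp (fun ω => center μ (D 0) ω * center μ (increment (ε 0) t) ω) 2 μ :=
    (hΔε.sub (memLp_const _)).mul' (hD.sub (memLp_const _))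
  rw [scoreSq_eq_sq (hmodel.integrable_error 0)]
  exact hprod.integrable_sq

lemma covariance_increment_error (hmodel : IsTWFEModel μ Y D β lam φ ε)
    (hiid : IsIIDSample μ Y D) (hΔε : MemLp (increment (ε 0) t) 2 μ) (hD : MemLp (D 0) 2 μ) :
    cov[D 0, increment (ε 0) t; μ] = 0 := by
  refine covariance_eq_zero_of_condExp_eq_zero (hiid.measurable_D 0) hD hΔε ?_
  refine (condExp_sub (hmodel.integrable_error 0 t) (hmodel.integrable_error 0 _) _).trans ?_
  filter_upwards [hmodel.condExp_error 0 t, hmodel.condExp_error 0 (refTime Tpre Tpost)]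
    with ω ht h0
  simp [ht, h0]

end IsTWFEModel

end Model

end EventStudy

theorem theorem3_general {Ω : Type*} [MeasurableSpace Ω] (μ : Measure Ω) [IsProbabilityMeasure μ]
    (Tpre Tpost : ℕ)
    (Y : ℕ → EventStudy.TimeSpan Tpre Tpost → Ω → ℝ) (D : ℕ → Ω → ℝ)
    (β : EventStudy.TimeSpan Tpre Tpost → ℝ) (lam : Ω → ℝ)
    (φ : EventStudy.TimeSpan Tpre Tpost → ℝ) (ε : EventStudy.TimeSpan Tpre Tpost → Ω → ℝ)
    (hiid : EventStudy.IsIIDSample μ Y D) (href : β (EventStudy.refTime Tpre Tpost) = 0)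
    (houtcome : ∀ t, ∀ᵐ ω ∂μ, Y 0 t ω = β t * D 0 ω + lam ω + φ t + ε t ω)
    (hε : ∀ t, Integrable (ε t) μ) (hD : MemLp (D 0) 2 μ) (hvar : Var[D 0; μ] ≠ 0)
    (hcov : ∀ t, cov[D 0, EventStudy.increment ε t; μ] = 0)
    (hscore : ∀ t, Integrable (EventStudy.scoreSq μ (D 0) ε t) μ) :
    (∀ t : EventStudy.TimeSpan Tpre Tpost,
      TendstoInDistribution
        (fun (n : ℕ) (ω : Ω) =>
          √(n : ℝ) * (EventStudy.betaHat n (fun i s => Y i s ω) (fun i => D i ω) t - β t))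
        atTop id (fun _ => μ) (gaussianReal 0 (EventStudy.asympVar μ (D 0) ε t).toNNReal)) ∧
    (∀ t : EventStudy.PanelTime Tpre Tpost,
      TendstoInDistribution
        (fun (n : ℕ) (ω : Ω) =>
          √(n : ℝ) * (EventStudy.betaHatPD n (fun i s => Y i (EventStudy.PanelTime.toSpan s) ω)
            (fun i => D i ω) t - β (EventStudy.PanelTime.toSpan t)))
        atTop id (fun _ => μ)
        (gaussianReal 0
          (EventStudy.asympVar μ (D 0) ε (EventStudy.PanelTime.toSpan t)).toNNReal)) := by
  have hbetaHat (t : EventStudy.TimeSpan Tpre Tpost) :=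
    EventStudy.tendstoInDistribution_betaHat hiid href houtcome hε hD hvar (hcov t) (hscore t)
  refine ⟨hbetaHat, fun t => ?_⟩
  have hPD (n : ℕ) (ω : Ω) :=
    EventStudy.betaHatPD_eq_betaHat n (fun i s => Y i s ω) (fun i => D i ω) t
  simpa only [hPD] using hbetaHat t.toSpan

theorem theorem3 {Ω : Type*} [MeasurableSpace Ω] (μ : Measure Ω) [IsProbabilityMeasure μ]
    (Tpre Tpost : ℕ)
    (Y : ℕ → EventStudy.TimeSpan Tpre Tpost → Ω → ℝ) (D : ℕ → Ω → ℝ)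
    (β : EventStudy.TimeSpan Tpre Tpost → ℝ) (lam : ℕ → Ω → ℝ)
    (φ : EventStudy.TimeSpan Tpre Tpost → ℝ)
    (ε : ℕ → EventStudy.TimeSpan Tpre Tpost → Ω → ℝ)
    (hmodel : EventStudy.IsTWFEModel μ Y D β lam φ ε)
    (hiid : EventStudy.IsIIDSample μ Y D)
    (hoverlap : 0 < μ {ω | D 0 ω = 1} ∧ μ {ω | D 0 ω = 1} < 1)
    (hmomY : ∀ t, Integrable (fun ω => Y 0 t ω ^ 4) μ)
    (hmomD : Integrable (fun ω => D 0 ω ^ 4) μ) :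
    (∀ t : EventStudy.TimeSpan Tpre Tpost,
      Integrable (EventStudy.scoreSq μ (D 0) (ε 0) t) μ ∧
      TendstoInDistribution
        (fun (n : ℕ) (ω : Ω) =>
          √(n : ℝ) * (EventStudy.betaHat n (fun i s => Y i s ω) (fun i => D i ω) t - β t))
        atTop id (fun _ => μ)
        (gaussianReal 0 (EventStudy.asympVar μ (D 0) (ε 0) t).toNNReal)) ∧
    (∀ t : EventStudy.PanelTime Tpre Tpost,
      TendstoInDistribution
        (fun (n : ℕ) (ω : Ω) =>
          √(n : ℝ) * (EventStudy.betaHatPD n (fun i s => Y i (EventStudy.PanelTime.toSpan s) ω)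
            (fun i => D i ω) t - β (EventStudy.PanelTime.toSpan t)))
        atTop id (fun _ => μ)
        (gaussianReal 0
          (EventStudy.asympVar μ (D 0) (ε 0) (EventStudy.PanelTime.toSpan t)).toNNReal)) := by
  have hD : MemLp (D 0) 4 μ := EventStudy.memLp_of_integrable_pow four_ne_zero
    (hiid.measurable_D 0).aestronglyMeasurable hmomD
  have hΔε := hmodel.memLp_four_increment hiid hmomY hD
  have hD2 : MemLp (D 0) 2 μ := hD.mono_exponent (by norm_num)
  have hscore := fun t => hmodel.integrable_scoreSq (hΔε t) hD
  have hcov := fun t =>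
    hmodel.covariance_increment_error hiid ((hΔε t).mono_exponent (by norm_num)) hD2
  have hvar := EventStudy.variance_ne_zero_of_measure_eq hD2 hoverlap.1 hoverlap.2
  obtain ⟨hbetaHat, hbetaHatPD⟩ := theorem3_general μ Tpre Tpost Y D β (lam 0) φ (ε 0) hiid
    hmodel.beta_ref (hmodel.outcome 0) (hmodel.integrable_error 0) hD2 hvar hcov hscore
  exact ⟨fun t => ⟨hscore t, hbetaHat t⟩, hbetaHatPD⟩
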